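/- Let $G$ be a finite connected simple graph with $n$ vertices and geodesic distance $d$. A \emph{block} of $G$ is a maximal connected induced subgraph having no cut vertex of its own; suppose that $G$ is a \emph{block graph}, i.e. every block of $G$ is a clique, and let $B_1,\dots,B_t$ be the blocks of $G$. For a set $S$ of vertices let $d(S)$ (the Steiner distance) be the minimum number of edges of a connected subgraph of $G$ containing all vertices of $S$, and put $$SW_3(G)=\sum_{S\subseteq V(G),\ |S|=3} d(S),\qquad W(G)=\sum_{\{u,v\}\subseteq V(G)} d(u,v).$$ For a graph $H$ with connected components $H_1,\dots,H_p$ let $$N_3(H)=\sum_{\{i,j,k\}\subseteq\{1,\dots,p\}} |V(H_i)|\,|V(H_j)|\,|V(H_k)|,$$ the sum being over three-element subsets (so $N_3(H)=0$ if $p<3$); this is the number of sets of three vertices lying in three distinct components of $H$. Let $G\setminus B_i$ be the graph obtained from $G$ by deleting all edges of $B_i$ and keeping all vertices. Then $$SW_3(G)=\frac{n-2}{2}\,W(G)+\frac12\sum_{i=1}^{t}N_3(G\setminus B_i).$$ Moreover, whenever $a,b,c$ are vertices of $G$ such that no vertex of $G$ lies simultaneously on a shortest path between $a$ and $b$, on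 one between $a$ and $c$ and on one between $b$ and $c$ (a non-modular triple), then $$d(\{a,b,c\})=\tfrac12\bigl(d(a,b)+d(a,c)+d(b,c)\bigr)+\tfrac12 .$$ -/

import Mathlib

namespace SimpleGraph

variable {V : Type*}

/-- `v` is a cut vertex of `H`: deleting `v` separates two other vertices which lie in the same
connected component of `H` (so deleting `v` splits a component). -/
def IsCutVertex (H : SimpleGraph V) (v : V) : Prop :=
  ∃ a b : ({v}ᶜ : Set V), H.Reachable a b ∧ ¬ (H.induce ({v}ᶜ : Set V)).Reachable a b

/-- A block, given by its vertex set: a maximal connected induced subgraph without cut vertices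
of its own. -/
def IsBlock (G : SimpleGraph V) (B : Set V) : Prop :=
  Maximal (fun s : Set V => (G.induce s).Connected ∧ ∀ v : s, ¬ (G.induce s).IsCutVertex v) B

/-- A block graph: every block is a clique. -/
def IsBlockGraph (G : SimpleGraph V) : Prop :=
  ∀ B : Set V, G.IsBlock B → G.IsClique B

open scoped Classical in
/-- The finite collection of all blocks of a finite graph. -/
noncomputable def blocks [Fintype V] (G : SimpleGraph V) : Finset (Set V) :=
  Finset.univ.filter fun B => G.IsBlock B

/-- `G ∖ B`: all edges of `G` inside `B` are deleted, all vertices are kept. -/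
def deleteBlock (G : SimpleGraph V) (B : Set V) : SimpleGraph V :=
  G.deleteEdges ((⊤ : G.Subgraph).induce B).edgeSet

/-- The Steiner distance of `S`: the minimum number of edges of a connected subgraph containing
all vertices of `S`. -/
noncomputable def steinerDist (G : SimpleGraph V) (S : Finset V) : ℕ :=
  sInf {k : ℕ | ∃ H : G.Subgraph, H.Connected ∧ (S : Set V) ⊆ H.verts ∧ H.edgeSet.encard = k}

/-- The Steiner `k`-Wiener index: the sum of the Steiner distances of all `k`-sets of vertices. -/
noncomputable def steinerWienerIndex [Fintype V] (k : ℕ) (G : SimpleGraph V) : ℕ :=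
  ∑ S ∈ (Finset.univ : Finset V).powersetCard k, G.steinerDist S

open scoped Classical in
/-- The Wiener index: the sum of the distances over all unordered pairs of vertices
(a diagonal pair contributes `0`). -/
noncomputable def wienerIndex [Fintype V] (G : SimpleGraph V) : ℕ :=
  ∑ e : Sym2 V, Sym2.lift ⟨fun u v => G.dist u v, fun _ _ => G.dist_comm⟩ e

open scoped Classical in
/-- `N₃(G)`: the sum of `n(C₁) n(C₂) n(C₃)` over all sets of three distinct connected
components. -/
noncomputable def N₃ [Fintype V] (G : SimpleGraph V) : ℕ :=
  ∑ T ∈ (Finset.univ : Finset G.ConnectedComponent).powersetCard 3, ∏ C ∈ T, C.supp.ncard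

/-- The interval `I(u, v)`: all vertices lying on a shortest path between `u` and `v`. -/
def geodesicInterval (G : SimpleGraph V) (u v : V) : Set V :=
  {w | ∃ p : G.Walk u v, p.length = G.dist u v ∧ w ∈ p.support}

/-- A modular triple: some vertex lies on shortest paths between each two of the three. -/
def IsModularTriple (G : SimpleGraph V) (a b c : V) : Prop :=
  (G.geodesicInterval a b ∩ G.geodesicInterval a c ∩ G.geodesicInterval b c).Nonempty

end SimpleGraph

namespace SimpleGraph

variable {V : Type*} {G : SimpleGraph V} {B : Set V}

/-! Write G∖B for `deleteBlock`. In a block graph each component of G∖B contains exactly one vertex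
of B, its gate, and every walk into the component from outside passes through it (`eq_of_reachable`,
`exists_gate`, `gate_mem_support`). A geodesic therefore uses at most one edge of each block, and
d(u,v) is the number of blocks B for which u and v lie in different components of G∖B
(`dist_eq_sepCount`).

For a triple whose members occupy k components of G∖B, a connected subgraph containing it needs at
least k - 1 edges of B. Twice k - 1 is the number of separated pairs, plus 1 when k = 3. Distinct
blocks share no edge, so summing over blocks bounds 2d({a,b,c}) below by the three distances plus
the number of blocks with k = 3 (`le_two_mul_steinerDist`).

The bound is attained by stars of geodesics: if some block has k = 3, centred at a gate; otherwise
the triple is modular (`isModularTriple`) and a median is the centre. Summing over triples, each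
pair is counted n - 2 times and each block contributes N₃(G∖B). -/

theorem deleteBlock_adj {u v : V} :
    (G.deleteBlock B).Adj u v ↔ G.Adj u v ∧ ¬ (u ∈ B ∧ v ∈ B) := by
  simp only [deleteBlock, deleteEdges_adj, Subgraph.mem_edgeSet, Subgraph.induce_adj,
    Subgraph.top_adj]
  tauto

theorem deleteBlock_le : G.deleteBlock B ≤ G := fun _ _ h => (deleteBlock_adj.1 h).1

theorem mem_edgeSet_induce_top {u v : V} :
    s(u, v) ∈ ((⊤ : G.Subgraph).induce B).edgeSet ↔ G.Adj u v ∧ u ∈ B ∧ v ∈ B := by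
  simp only [Subgraph.mem_edgeSet, Subgraph.induce_adj, Subgraph.top_adj]
  tauto

/-! ### Cut vertices, maximality and intersections of blocks -/

/-- A vertex set in which every vertex is joined to a fixed clique induces a preconnected graph. -/
theorem induce_preconnected_of_clique {C T : Set V} (hC : G.IsClique C) (hCT : C ⊆ T)
    (h : ∀ w ∈ T, ∃ z ∈ C, ∃ p : G.Walk w z, ∀ x ∈ p.support, x ∈ T) :
    (G.induce T).Preconnected := by
  rintro ⟨a, ha⟩ ⟨b, hb⟩
  obtain ⟨z, hz, p, hp⟩ := h a ha
  obtain ⟨y, hy, q, hq⟩ := h b hb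
  have h1 : (G.induce T).Reachable ⟨a, ha⟩ ⟨z, hCT hz⟩ := ⟨p.induce T hp⟩
  have h2 : (G.induce T).Reachable ⟨b, hb⟩ ⟨y, hCT hy⟩ := ⟨q.induce T hq⟩
  have h3 : (G.induce T).Reachable ⟨z, hCT hz⟩ ⟨y, hCT hy⟩ := by
    by_cases hzy : z = y
    · subst hzy; exact Reachable.refl _
    · exact Adj.reachable (by simpa using hC hz hy hzy)
  exact h1.trans (h3.trans h2.symm)

theorem not_isCutVertex_of_preconnected {S : Set V} (v : S)
    (h : (G.induce (S \ {(v : V)})).Preconnected) : ¬ (G.induce S).IsCutVertex v := by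
  rintro ⟨⟨⟨a, ha⟩, hav⟩, ⟨⟨b, hb⟩, hbv⟩, -, hn⟩
  have hav' : a ∉ ({(v : V)} : Set V) := fun h' => hav (Subtype.ext h')
  have hbv' : b ∉ ({(v : V)} : Set V) := fun h' => hbv (Subtype.ext h')
  refine hn ?_
  let f : G.induce (S \ {(v : V)}) →g (G.induce S).induce ({v}ᶜ : Set S) :=
    { toFun := fun x => ⟨⟨x.1, x.2.1⟩, fun h' => x.2.2 (congrArg Subtype.val h')⟩
      map_rel' := fun h' => h' }
  exact (h ⟨a, ha, hav'⟩ ⟨b, hb, hbv'⟩).map f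

/-- A maximality criterion: a set containing a clique block, such that each vertex is joined to
the clique even after the deletion of another vertex, is contained in the block. -/
theorem IsBlock.eq_of_clique {S C : Set V} (hB : G.IsBlock B) (hBS : B ⊆ S) (hC : G.IsClique C)
    (hCS : C ⊆ S) (hC1 : ∀ w ∈ S, ∃ z ∈ C, ∃ p : G.Walk w z, ∀ x ∈ p.support, x ∈ S)
    (h : ∀ v ∈ S, ∀ w ∈ S, w ≠ v → ∃ z ∈ C, ∃ p : G.Walk w z, ∀ x ∈ p.support, x ∈ S \ {v}) :
    S ⊆ B := by
  refine hB.2 ⟨?_, ?_⟩ hBS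
  · have : Nonempty B := hB.1.1.nonempty
    obtain ⟨b⟩ := this
    have : Nonempty S := ⟨⟨b, hBS b.2⟩⟩
    exact ⟨induce_preconnected_of_clique hC hCS hC1⟩
  · intro v
    refine not_isCutVertex_of_preconnected v
      (induce_preconnected_of_clique (C := C \ {(v : V)}) (hC.subset Set.sdiff_subset)
        (Set.sdiff_subset_sdiff_left hCS) ?_)
    rintro w ⟨hw, hwv⟩
    obtain ⟨z, hz, p, hp⟩ := h v v.2 w hw hwv
    exact ⟨z, ⟨hz, (hp z p.end_mem_support).2⟩, p, hp⟩

theorem IsBlock.nonempty (hB : G.IsBlock B) : B.Nonempty :=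
  let ⟨b⟩ := hB.1.1.nonempty; ⟨b, b.2⟩

theorem exists_isBlock_of_adj [Finite V] {u v : V} (h : G.Adj u v) :
    ∃ B, G.IsBlock B ∧ u ∈ B ∧ v ∈ B := by
  have hcl : G.IsClique ({u, v} : Set V) := by
    rw [isClique_pair]; exact fun _ => h
  have hP : (G.induce ({u, v} : Set V)).Connected ∧
      ∀ x : ({u, v} : Set V), ¬ (G.induce ({u, v} : Set V)).IsCutVertex x := by
    constructor
    · have : Nonempty ({u, v} : Set V) := ⟨⟨u, by simp⟩⟩
      exact ⟨induce_preconnected_of_clique hcl subset_rfl fun w hw => ⟨w, hw, .nil, by simpa using hw⟩⟩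
    · intro x
      exact not_isCutVertex_of_preconnected x (induce_preconnected_of_clique
        (hcl.subset Set.sdiff_subset) subset_rfl fun w hw => ⟨w, hw, .nil, by simpa using hw⟩)
  obtain ⟨B, hle, hB⟩ := (Set.toFinite {s : Set V | (G.induce s).Connected ∧
    ∀ v : s, ¬ (G.induce s).IsCutVertex v}).exists_le_maximal hP
  exact ⟨B, hB, hle (by simp), hle (by simp)⟩

/-- After deletion of any vertex from B ∪ C, one of x, y survives and is adjacent to all the rest of
both cliques. So B ∪ C has no cut vertex, and maximality of B applies. -/
theorem IsBlockGraph.subset_of_common (hG : G.IsBlockGraph) {C : Set V} (hB : G.IsBlock B)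
    (hC : G.IsBlock C) {x y : V} (hxy : x ≠ y) (hxB : x ∈ B) (hyB : y ∈ B) (hxC : x ∈ C)
    (hyC : y ∈ C) : C ⊆ B := by
  have hBC := hG B hB
  have hCC := hG C hC
  refine Set.subset_union_right.trans
    (hB.eq_of_clique (S := B ∪ C) (C := B) Set.subset_union_left hBC Set.subset_union_left ?_ ?_)
  · rintro w (hw | hw)
    · exact ⟨w, hw, .nil, by simp [hw]⟩
    · by_cases hwx : w = x
      · subst hwx; exact ⟨w, hxB, .nil, by simp [hxB]⟩
      · exact ⟨x, hxB, (hCC hw hxC hwx).toWalk, by simp [hw, hxB]⟩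
  · rintro v - w hw hwv
    have key : ∀ z, z ∈ B → z ∈ C → z ≠ v → w ∈ C →
        ∃ z ∈ B, ∃ p : G.Walk w z, ∀ x ∈ p.support, x ∈ (B ∪ C) \ {v} := by
      intro z hzB hzC hzv hwC
      by_cases hwz : w = z
      · subst hwz; exact ⟨w, hzB, .nil, by simp [hzB, hzv]⟩
      · exact ⟨z, hzB, (hCC hwC hzC hwz).toWalk, by simp [hwC, hzB, hwv, hzv]⟩
    rcases hw with hw | hw
    · exact ⟨w, hw, .nil, by simp [hw, hwv]⟩
    · by_cases hxv : x = v
      · exact key y hyB hyC (fun h => hxy (hxv.trans h.symm)) hw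
      · exact key x hxB hxC hxv hw

theorem IsBlockGraph.block_eq (hG : G.IsBlockGraph) {C : Set V} (hB : G.IsBlock B)
    (hC : G.IsBlock C) {x y : V} (hxy : x ≠ y) (hxB : x ∈ B) (hyB : y ∈ B) (hxC : x ∈ C)
    (hyC : y ∈ C) : B = C :=
  (hG.subset_of_common hC hB hxy hxC hyC hxB hyB).antisymm
    (hG.subset_of_common hB hC hxy hxB hyB hxC hyC)

/-! ### Components of G∖B and their gates -/

/-- Distinct vertices of a block of a block graph are separated by deleting the block. -/
theorem IsBlockGraph.eq_of_reachable (hG : G.IsBlockGraph) (hB : G.IsBlock B) {x y : V}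
    (hx : x ∈ B) (hy : y ∈ B) (h : (G.deleteBlock B).Reachable x y) : x = y := by
  classical
  by_contra hxy
  obtain ⟨q, hq⟩ := h.exists_isPath
  -- A path of G∖B with both ends in B can be added to B without creating a cut vertex, so
  -- maximality puts it inside B; but then its first edge has been deleted.
  have hsub : {w | w ∈ q.support} ⊆ B := by
    set p : G.Walk x y := q.mapLe deleteBlock_le with hpdef
    have hp : p.IsPath := (Walk.isPath_mapLe deleteBlock_le).2 hq
    have hs : ∀ w, w ∈ q.support ↔ w ∈ p.support := fun w => by simp [hpdef]
    have htake : ∀ w (hw : w ∈ p.support), ∀ z ∈ (p.takeUntil w hw).support, z ∈ q.support :=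
      fun w hw z hz => (hs z).2 (p.support_takeUntil_subset_support hw hz)
    have hdrop : ∀ w (hw : w ∈ p.support), ∀ z ∈ (p.dropUntil w hw).support, z ∈ q.support :=
      fun w hw z hz => (hs z).2 (p.support_dropUntil_subset_support hw hz)
    refine Set.subset_union_right.trans (hB.eq_of_clique (S := B ∪ {w | w ∈ q.support}) (C := B)
      Set.subset_union_left (hG B hB) Set.subset_union_left ?_ ?_)
    · rintro w (hw | hw)
      · exact ⟨w, hw, .nil, by simp [hw]⟩
      · have hw' := (hs w).1 hw
        exact ⟨y, hy, p.dropUntil w hw', fun z hz => Or.inr (hdrop w hw' z hz)⟩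
    · rintro v - w (hw | hw) hwv
      · exact ⟨w, hw, .nil, by simp [hw, hwv]⟩
      · have hw' := (hs w).1 hw
        -- A path visits v at most once, so from w at least one of the two directions reaches B
        -- while avoiding v.
        by_cases hv : v ∈ (p.dropUntil w hw').support
        · refine ⟨x, hx, (p.takeUntil w hw').reverse, fun z hz => ?_⟩
          rw [Walk.support_reverse, List.mem_reverse] at hz
          refine ⟨Or.inr (htake w hw' z hz), ?_⟩
          rintro rfl
          have hnd := hp.support_nodup
          rw [← p.take_spec hw', Walk.support_append, List.nodup_append] at hnd
          rw [Walk.mem_support_iff] at hv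
          rcases hv with hv | hv
          · exact hwv hv.symm
          · exact hnd.2.2 z hz z hv rfl
        · refine ⟨y, hy, p.dropUntil w hw', fun z hz => ⟨Or.inr (hdrop w hw' z hz), ?_⟩⟩
          rintro rfl
          exact hv hz
  cases q with
  | nil => exact hxy rfl
  | cons hadj r => exact (deleteBlock_adj.1 hadj).2 ⟨hx, hsub (by simp)⟩

theorem reachable_deleteBlock_or_mem {u v : V} (h : G.Adj u v) :
    (G.deleteBlock B).Reachable u v ∨ u ∈ B ∧ v ∈ B := by
  by_cases hB : u ∈ B ∧ v ∈ B
  · exact Or.inr hB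
  · exact Or.inl (deleteBlock_adj.2 ⟨h, hB⟩).reachable

/-- Every component of `G ∖ B` meets the block `B`. -/
theorem exists_gate (hconn : G.Connected) (hB : G.IsBlock B) (v : V) :
    ∃ q ∈ B, (G.deleteBlock B).Reachable v q := by
  obtain ⟨b, hb⟩ := hB.nonempty
  obtain ⟨p⟩ := hconn.preconnected v b
  induction p with
  | nil => exact ⟨_, hb, Reachable.refl _⟩
  | cons h p ih =>
    obtain ⟨q, hq, hr⟩ := ih hb
    rcases reachable_deleteBlock_or_mem h with h' | ⟨h', -⟩
    · exact ⟨q, hq, h'.trans hr⟩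
    · exact ⟨_, h', Reachable.refl _⟩

/-- The walk can enter the component of v only along an edge of B, and the endpoint of that edge
inside the component is its only vertex in B. -/
theorem IsBlockGraph.gate_mem_support (hG : G.IsBlockGraph) (hB : G.IsBlock B) {u v q : V}
    (hq : q ∈ B) (hqv : (G.deleteBlock B).Reachable q v)
    (huv : ¬ (G.deleteBlock B).Reachable u v) (p : G.Walk u v) : q ∈ p.support := by
  induction p with
  | nil => exact absurd (Reachable.refl _) huv
  | @cons u w v h p ih =>
    rw [Walk.support_cons]
    by_cases hw : (G.deleteBlock B).Reachable w v
    · rcases reachable_deleteBlock_or_mem (B := B) h with h' | ⟨-, hwB⟩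
      · exact absurd (h'.trans hw) huv
      · rw [hG.eq_of_reachable hB hq hwB (hqv.trans hw.symm)]
        exact List.mem_cons_of_mem _ p.start_mem_support
    · exact List.mem_cons_of_mem _ (ih hqv hw)

theorem Walk.dist_add_dist_of_mem_support {u v w : V} (p : G.Walk u v)
    (hp : p.length = G.dist u v) (hw : w ∈ p.support) :
    G.dist u w + G.dist w v ≤ G.dist u v := by
  classical
  have h1 := dist_le (p.takeUntil w hw)
  have h2 := dist_le (p.dropUntil w hw)
  have h3 := congrArg Walk.length (p.take_spec hw)
  rw [Walk.length_append] at h3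
  lia

theorem mem_geodesicInterval_iff (hconn : G.Connected) {u v w : V} :
    w ∈ G.geodesicInterval u v ↔ G.dist u w + G.dist w v = G.dist u v := by
  constructor
  · rintro ⟨p, hp, hw⟩
    exact (p.dist_add_dist_of_mem_support hp hw).antisymm hconn.dist_triangle
  · intro h
    obtain ⟨p, hp⟩ := hconn.exists_walk_length_eq_dist u w
    obtain ⟨q, hq⟩ := hconn.exists_walk_length_eq_dist w v
    exact ⟨p.append q, by rw [Walk.length_append, hp, hq, h], by simp⟩

theorem IsBlockGraph.dist_gate (hG : G.IsBlockGraph) (hconn : G.Connected) (hB : G.IsBlock B)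
    {u v q : V} (hq : q ∈ B) (hqv : (G.deleteBlock B).Reachable q v)
    (huv : ¬ (G.deleteBlock B).Reachable u v) : G.dist u q + G.dist q v = G.dist u v := by
  obtain ⟨p, hp⟩ := hconn.exists_walk_length_eq_dist u v
  exact (mem_geodesicInterval_iff hconn).1 ⟨p, hp, hG.gate_mem_support hB hq hqv huv p⟩

/-! ### Distance as a count of separating blocks -/

open scoped Classical in
/-- The number of blocks whose deletion separates `u` from `v`. -/
noncomputable def sepCount [Fintype V] (G : SimpleGraph V) (u v : V) : ℕ :=
  ∑ B ∈ G.blocks, if (G.deleteBlock B).Reachable u v then 0 else 1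

theorem mem_blocks [Fintype V] : B ∈ G.blocks ↔ G.IsBlock B := by
  simp [blocks]

/-- Induction along a geodesic: its first edge lies in one block only, and removing that edge lowers
the count by exactly the contribution of this block. -/
theorem IsBlockGraph.dist_eq_sepCount [Fintype V] (hG : G.IsBlockGraph) (hconn : G.Connected)
    (u v : V) : G.dist u v = G.sepCount u v := by
  classical
  obtain ⟨p, hp⟩ := hconn.exists_walk_length_eq_dist u v
  induction p with
  | nil => simp [sepCount]
  | @cons u w v huw p ih =>
    rw [Walk.length_cons] at hp
    have hpw : p.length = G.dist w v := by
      refine le_antisymm ?_ (dist_le p)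
      have := hconn.dist_triangle (u := u) (v := w) (w := v)
      rw [dist_eq_one_iff_adj.2 huw] at this
      lia
    obtain ⟨B, hB, hu, hw⟩ := exists_isBlock_of_adj huw
    have huw' : ¬ (G.deleteBlock B).Reachable u w := fun h =>
      huw.ne (hG.eq_of_reachable hB hu hw h)
    -- Otherwise the gate of v would be at distance 1 from w and at most 1 from u, so stepping from
    -- u to w would bring no gain.
    have hwv : (G.deleteBlock B).Reachable w v := by
      by_contra hwv
      obtain ⟨q, hq, hvq⟩ := exists_gate hconn hB v
      have hd := hG.dist_gate hconn hB hq hvq.symm hwv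
      have hwq : w ≠ q := by rintro rfl; exact hwv hvq.symm
      have hd1 : G.dist w q = 1 := dist_eq_one_iff_adj.2 (hG B hB hw hq hwq)
      have huq : G.dist u q ≤ 1 := by
        by_cases h : u = q
        · simp [h]
        · exact (dist_eq_one_iff_adj.2 (hG B hB hu hq h)).le
      have := hconn.dist_triangle (u := u) (v := q) (w := v)
      lia
    have huv : ¬ (G.deleteBlock B).Reachable u v := fun h => huw' (h.trans hwv.symm)
    have hBm : B ∈ G.blocks := mem_blocks.2 hB
    rw [← hp, hpw, ih hpw, sepCount, sepCount, ← Finset.add_sum_erase _ _ hBm,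
      ← Finset.add_sum_erase _ (fun B => if (G.deleteBlock B).Reachable u v then 0 else 1) hBm,
      if_pos hwv, if_neg huv, zero_add, add_comm]
    congr 1
    refine Finset.sum_congr rfl fun C hC => ?_
    rw [Finset.mem_erase, mem_blocks] at hC
    have huwC : (G.deleteBlock C).Reachable u w := by
      refine (reachable_deleteBlock_or_mem huw).resolve_right fun h => hC.1 ?_
      exact hG.block_eq hC.2 hB huw.ne h.1 h.2 hu hw
    have : (G.deleteBlock C).Reachable w v ↔ (G.deleteBlock C).Reachable u v :=
      ⟨huwC.trans, huwC.symm.trans⟩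
    simp [this]

/-! ### Unseparated triples are modular -/

/-- Deleting `B` puts `a`, `b`, `c` into three distinct components. -/
def Separates (G : SimpleGraph V) (B : Set V) (a b c : V) : Prop :=
  ¬ (G.deleteBlock B).Reachable a b ∧ ¬ (G.deleteBlock B).Reachable a c ∧
    ¬ (G.deleteBlock B).Reachable b c

/-- A triple not separated by any block is modular. -/
theorem IsBlockGraph.isModularTriple [Finite V] (hG : G.IsBlockGraph) (hconn : G.Connected)
    {a b c : V} (h : ∀ B, G.IsBlock B → ¬ G.Separates B a b c) : G.IsModularTriple a b c := by
  classical
  have := Fintype.ofFinite V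
  have hne : (Finset.univ.filter fun x => G.dist a x + G.dist x b = G.dist a b ∧
      G.dist a x + G.dist x c = G.dist a c).Nonempty := ⟨a, by simp⟩
  -- The candidate median is the point farthest from a that is common to the intervals from a to b
  -- and from a to c.
  obtain ⟨x, hx, hmax⟩ := Finset.exists_max_image _ (fun x => G.dist a x) hne
  simp only [Finset.mem_filter, Finset.mem_univ, true_and] at hx hmax
  obtain ⟨hxb, hxc⟩ := hx
  refine ⟨x, ⟨(mem_geodesicInterval_iff hconn).2 hxb, (mem_geodesicInterval_iff hconn).2 hxc⟩,
    (mem_geodesicInterval_iff hconn).2 ?_⟩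
  by_contra hbc
  have hlt : G.sepCount b c < G.sepCount b x + G.sepCount x c := by
    rw [← hG.dist_eq_sepCount hconn, ← hG.dist_eq_sepCount hconn, ← hG.dist_eq_sepCount hconn]
    have := hconn.dist_triangle (u := b) (v := x) (w := c)
    lia
  rw [sepCount, sepCount, sepCount, ← Finset.sum_add_distrib] at hlt
  -- If x is off every geodesic from b to c, some block is counted more often through x than
  -- directly; such a block must separate x from both b and c.
  obtain ⟨B, hBm, hBlt⟩ := Finset.exists_lt_of_sum_lt hlt
  have hB := mem_blocks.1 hBm
  have hbx : ¬ (G.deleteBlock B).Reachable b x := by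
    intro h1
    by_cases h2 : (G.deleteBlock B).Reachable x c
    · simp [h1, h2] at hBlt
    · have h3 : ¬ (G.deleteBlock B).Reachable b c := fun h' => h2 (h1.symm.trans h')
      simp [h1, h2, h3] at hBlt
  have hxc' : ¬ (G.deleteBlock B).Reachable x c := by
    intro h2
    have h3 : ¬ (G.deleteBlock B).Reachable b c := fun h' => hbx (h'.trans h2.symm)
    simp [hbx, h2, h3] at hBlt
  obtain ⟨p, hp, hxp⟩ := exists_gate hconn hB x
  have hax : (G.deleteBlock B).Reachable a x := by
    by_contra hax
    obtain ⟨r, hr, har⟩ := exists_gate hconn hB a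
    obtain ⟨q, hq, hbq⟩ := exists_gate hconn hB b
    -- a geodesic from `a` to `b` uses at most one edge of `B`
    have e1 := hG.dist_gate hconn hB hp hxp.symm hax
    have e2 := hG.dist_gate hconn hB hr har.symm (u := p) (fun h' => hax (h'.symm.trans hxp.symm))
    have e3 := hG.dist_gate hconn hB hq hbq.symm (u := x) (fun h' => hbx h'.symm)
    have e4 := hG.dist_gate hconn hB hp hxp.symm (u := q) (fun h' => hbx (hbq.trans h'))
    have hrp : r ≠ p := by rintro rfl; exact hax (har.trans hxp.symm)
    have hqp : q ≠ p := by rintro rfl; exact hbx (hbq.trans hxp.symm)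
    have d1 : G.dist r p = 1 := dist_eq_one_iff_adj.2 (hG B hB hr hp hrp)
    have d2 : G.dist q p = 1 := dist_eq_one_iff_adj.2 (hG B hB hq hp hqp)
    have d3 : G.dist r q ≤ 1 := by
      by_cases h' : r = q
      · simp [h']
      · exact (dist_eq_one_iff_adj.2 (hG B hB hr hq h')).le
    have t1 := hconn.dist_triangle (u := a) (v := r) (w := b)
    have t2 := hconn.dist_triangle (u := r) (v := q) (w := b)
    have c1 := G.dist_comm (u := p) (v := r)
    have c2 := G.dist_comm (u := p) (v := a)
    have c3 := G.dist_comm (u := a) (v := r)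
    have c4 := G.dist_comm (u := q) (v := x)
    lia
  have hbc' : (G.deleteBlock B).Reachable b c := by
    by_contra hbc'
    exact h B hB ⟨fun h' => hbx (h'.symm.trans hax), fun h' => hxc' (hax.symm.trans h'), hbc'⟩
  -- The common gate q of b and c lies on geodesics from x to both, hence in both intervals and
  -- strictly farther from a than x, against the choice of x.
  obtain ⟨q, hq, hbq⟩ := exists_gate hconn hB b
  have e1 := hG.dist_gate hconn hB hq hbq.symm (u := x) (fun h' => hbx h'.symm)
  have e2 := hG.dist_gate hconn hB hq (hbq.symm.trans hbc') (u := x) hxc'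
  have hxq : x ≠ q := by rintro rfl; exact hbx hbq
  have hpos := hconn.pos_dist_of_ne hxq
  have t1 := hconn.dist_triangle (u := a) (v := x) (w := q)
  have t2 := hconn.dist_triangle (u := a) (v := q) (w := b)
  have t3 := hconn.dist_triangle (u := a) (v := q) (w := c)
  have := hmax q (by lia)
  lia

/-! ### Upper bounds for the Steiner distance by stars -/

theorem exists_connected_subgraph_star [Finite V] {a b c m : V} (p : G.Walk a m) (q : G.Walk b m)
    (r : G.Walk c m) : ∃ H : G.Subgraph, H.Connected ∧ a ∈ H.verts ∧ b ∈ H.verts ∧ c ∈ H.verts ∧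
      H.edgeSet.encard ≤ (p.length + q.length + r.length : ℕ) := by
  classical
  have hcard : ∀ {x : V} (p : G.Walk x m), p.toSubgraph.edgeSet.encard ≤ (p.length : ℕ) := by
    intro x p
    have h : p.toSubgraph.edgeSet = (p.edges.toFinset : Set (Sym2 V)) := by
      ext e; simp
    rw [h, Set.encard_coe_eq_coe_finsetCard]
    exact_mod_cast p.edges.toFinset_card_le.trans p.length_edges.le
  have hpq : (p.toSubgraph ⊔ q.toSubgraph).Connected :=
    Subgraph.connected_sup p.toSubgraph_connected.preconnected q.toSubgraph_connected.preconnected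
      ⟨m, p.end_mem_verts_toSubgraph, q.end_mem_verts_toSubgraph⟩
  refine ⟨p.toSubgraph ⊔ q.toSubgraph ⊔ r.toSubgraph,
    Subgraph.connected_sup hpq.preconnected r.toSubgraph_connected.preconnected
      ⟨m, Or.inl p.end_mem_verts_toSubgraph, r.end_mem_verts_toSubgraph⟩,
    Or.inl (Or.inl p.start_mem_verts_toSubgraph), Or.inl (Or.inr q.start_mem_verts_toSubgraph),
    Or.inr r.start_mem_verts_toSubgraph, ?_⟩
  rw [Subgraph.edgeSet_sup, Subgraph.edgeSet_sup, Nat.cast_add, Nat.cast_add]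
  exact (Set.encard_union_le _ _).trans (add_le_add ((Set.encard_union_le _ _).trans
    (add_le_add (hcard p) (hcard q))) (hcard r))

theorem Connected.steinerDist_le [Finite V] [DecidableEq V] (hconn : G.Connected) (a b c m : V) :
    G.steinerDist {a, b, c} ≤ G.dist a m + G.dist b m + G.dist c m := by
  obtain ⟨p, hp⟩ := hconn.exists_walk_length_eq_dist a m
  obtain ⟨q, hq⟩ := hconn.exists_walk_length_eq_dist b m
  obtain ⟨r, hr⟩ := hconn.exists_walk_length_eq_dist c m
  obtain ⟨H, hH, ha, hb, hc, hle⟩ := exists_connected_subgraph_star p q r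
  obtain ⟨k, hk, hkle⟩ := ENat.le_natCast_iff.1 hle
  rw [hp, hq, hr] at hkle
  unfold steinerDist
  refine le_trans (Nat.sInf_le (m := k) ?_) hkle
  refine ⟨H, hH, ?_, hk⟩
  intro x hx
  simp only [Finset.coe_insert, Finset.coe_singleton, Set.mem_insert_iff,
    Set.mem_singleton_iff] at hx
  rcases hx with rfl | rfl | rfl <;> assumption

/-- Connectedness makes the set of sizes nonempty, so its `sInf` is an attained minimum rather than
the default 0. -/
theorem Connected.exists_subgraph_steinerDist [Finite V] [DecidableEq V] (hconn : G.Connected)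
    (a b c : V) : ∃ H : G.Subgraph, H.Connected ∧ a ∈ H.verts ∧ b ∈ H.verts ∧ c ∈ H.verts ∧
      H.edgeSet.encard = G.steinerDist {a, b, c} := by
  obtain ⟨p⟩ := hconn.preconnected a c
  obtain ⟨q⟩ := hconn.preconnected b c
  obtain ⟨H, hH, ha, hb, hc, hle⟩ := exists_connected_subgraph_star p q .nil
  obtain ⟨k, hk, -⟩ := ENat.le_natCast_iff.1 hle
  have hsub : (({a, b, c} : Finset V) : Set V) ⊆ H.verts := by
    intro x hx
    simp only [Finset.coe_insert, Finset.coe_singleton, Set.mem_insert_iff,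
      Set.mem_singleton_iff] at hx
    rcases hx with rfl | rfl | rfl <;> assumption
  obtain ⟨K, hK, hS, hcard⟩ := Nat.sInf_mem (s := {k : ℕ | ∃ H : G.Subgraph, H.Connected ∧
    ((({a, b, c} : Finset V) : Set V)) ⊆ H.verts ∧ H.edgeSet.encard = k}) ⟨k, H, hH, hsub, hk⟩
  exact ⟨K, hK, hS (by simp), hS (by simp), hS (by simp), hcard⟩

/-! ### Lower bound for the Steiner distance -/

/-- In a connected subgraph `H`, each vertex is joined in `G ∖ B` to a prescribed vertex `z` or
to an endpoint of an edge of `H` inside `B`. -/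
theorem Subgraph.Connected.exists_reachable_deleteBlock {H : G.Subgraph} (hH : H.Connected)
    {u z : V} (hu : u ∈ H.verts) (hz : z ∈ H.verts) : ∃ w, (G.deleteBlock B).Reachable u w ∧
      (w = z ∨ ∃ e ∈ H.edgeSet, e ∈ ((⊤ : G.Subgraph).induce B).edgeSet ∧ w ∈ e) := by
  obtain ⟨p⟩ := hH.coe.preconnected ⟨u, hu⟩ ⟨z, hz⟩
  suffices ∀ (x y : H.verts), H.coe.Walk x y → ∃ w, (G.deleteBlock B).Reachable x w ∧
      (w = y ∨ ∃ e ∈ H.edgeSet, e ∈ ((⊤ : G.Subgraph).induce B).edgeSet ∧ w ∈ e) from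
    this _ _ p
  intro x y p
  induction p with
  | nil => exact ⟨_, Reachable.refl _, Or.inl rfl⟩
  | @cons x w y h p ih =>
    have h' : H.Adj x w := h
    rcases reachable_deleteBlock_or_mem (B := B) h'.adj_sub with hr | hr
    · obtain ⟨t, ht, ht'⟩ := ih
      exact ⟨t, hr.trans ht, ht'⟩
    · exact ⟨x, Reachable.refl _, Or.inr ⟨s(x, w), h',
        mem_edgeSet_induce_top.2 ⟨h'.adj_sub, hr⟩, by simp⟩⟩

open scoped Classical in
/-- Twice the number of components of `G ∖ B` meeting `{a, b, c}`, minus two. -/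
noncomputable def sepWeight (G : SimpleGraph V) (B : Set V) (a b c : V) : ℕ :=
  (if (G.deleteBlock B).Reachable a b then 0 else 1) +
    (if (G.deleteBlock B).Reachable a c then 0 else 1) +
    (if (G.deleteBlock B).Reachable b c then 0 else 1) + if G.Separates B a b c then 1 else 0

theorem sepWeight_le_four (a b c : V) : G.sepWeight B a b c ≤ 4 := by
  unfold sepWeight; split_ifs <;> lia

/-- By pigeonhole two of the three vertices share a component, which removes one pair term and the
triple term. -/
theorem sepWeight_le_two_of_reachable {a b c : V} (h : ∃ x y, ∀ v ∈ [a, b, c],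
    (G.deleteBlock B).Reachable v x ∨ (G.deleteBlock B).Reachable v y) :
    G.sepWeight B a b c ≤ 2 := by
  obtain ⟨x, y, h⟩ := h
  simp only [List.mem_cons, List.not_mem_nil, or_false, forall_eq_or_imp, forall_eq] at h
  unfold sepWeight Separates
  have key : ∀ {u v w : V}, (G.deleteBlock B).Reachable u w → (G.deleteBlock B).Reachable v w →
      (G.deleteBlock B).Reachable u v := fun h1 h2 => h1.trans h2.symm
  obtain ⟨ha, hb, hc⟩ := h
  have : (G.deleteBlock B).Reachable a b ∨ (G.deleteBlock B).Reachable a c ∨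
      (G.deleteBlock B).Reachable b c := by
    rcases ha with ha | ha <;> rcases hb with hb | hb <;> rcases hc with hc | hc <;>
      first
        | exact Or.inl (key ha hb)
        | exact Or.inr (Or.inl (key ha hc))
        | exact Or.inr (Or.inr (key hb hc))
  rcases this with h | h | h <;> simp only [h, not_true_eq_false, false_and, and_false, if_true,
    if_false] <;> split_ifs <;> lia

theorem sepWeight_eq_zero {a b c : V} (hb : (G.deleteBlock B).Reachable b a)
    (hc : (G.deleteBlock B).Reachable c a) : G.sepWeight B a b c = 0 := by
  simp [sepWeight, Separates, hb.symm, hc.symm, hb.trans hc.symm]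

-- Two edges of H in B already allow the maximal weight 4. With one edge, every vertex of H is
-- joined in G∖B to one of its ends; with none, H stays within one component.
open scoped Classical in
theorem Subgraph.Connected.sepWeight_le {H : G.Subgraph} (hH : H.Connected) {a b c : V}
    (ha : a ∈ H.verts) (hb : b ∈ H.verts) (hc : c ∈ H.verts) (E : Finset (Sym2 V))
    (hE : ∀ e, e ∈ H.edgeSet → e ∈ E) : G.sepWeight B a b c ≤
      2 * (E.filter fun e => e ∈ ((⊤ : G.Subgraph).induce B).edgeSet).card := by
  set F := E.filter fun e => e ∈ ((⊤ : G.Subgraph).induce B).edgeSet with hF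
  have hmem : ∀ e, e ∈ H.edgeSet → e ∈ ((⊤ : G.Subgraph).induce B).edgeSet → e ∈ F :=
    fun e h1 h2 => Finset.mem_filter.2 ⟨hE e h1, h2⟩
  rcases Nat.lt_or_ge 1 F.card with h2 | h1
  · exact (sepWeight_le_four a b c).trans (by lia)
  by_cases hedge : ∃ e ∈ H.edgeSet, e ∈ ((⊤ : G.Subgraph).induce B).edgeSet
  · obtain ⟨e1, he1, he1B⟩ := hedge
    have hpos : 0 < F.card := Finset.card_pos.2 ⟨e1, hmem _ he1 he1B⟩
    refine le_trans ?_ (show 2 ≤ 2 * F.card by lia)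
    induction e1 with
    | h x y =>
    have hall : ∀ e' ∈ F, e' = s(x, y) := fun e' he' =>
      Finset.card_le_one.1 h1 e' he' _ (hmem _ he1 he1B)
    have hx : x ∈ H.verts := H.mem_verts_of_mem_edge he1 (by simp)
    have : ∀ v ∈ H.verts, (G.deleteBlock B).Reachable v x ∨
        (G.deleteBlock B).Reachable v y := by
      intro v hv
      obtain ⟨w, hw, rfl | ⟨e', he', heB, hwe⟩⟩ :=
        hH.exists_reachable_deleteBlock (B := B) hv hx
      · exact Or.inl hw
      · rw [hall e' (hmem _ he' heB), Sym2.mem_iff] at hwe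
        rcases hwe with rfl | rfl
        · exact Or.inl hw
        · exact Or.inr hw
    refine sepWeight_le_two_of_reachable ⟨x, y, ?_⟩
    simp only [List.mem_cons, List.not_mem_nil, or_false, forall_eq_or_imp, forall_eq]
    exact ⟨this a ha, this b hb, this c hc⟩
  · have : ∀ v ∈ H.verts, (G.deleteBlock B).Reachable v a := by
      intro v hv
      obtain ⟨w, hw, rfl | ⟨e, he, heB, -⟩⟩ :=
        hH.exists_reachable_deleteBlock (B := B) hv ha
      · exact hw
      · exact absurd ⟨e, he, heB⟩ hedge
    rw [sepWeight_eq_zero (this b hb) (this c hc)]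
    exact Nat.zero_le _

open scoped Classical in
theorem IsBlockGraph.sum_sepWeight_le [Fintype V] [DecidableEq V] (hG : G.IsBlockGraph)
    (hconn : G.Connected) (a b c : V) :
    ∑ B ∈ G.blocks, G.sepWeight B a b c ≤ 2 * G.steinerDist {a, b, c} := by
  obtain ⟨H, hH, ha, hb, hc, hcard⟩ := hconn.exists_subgraph_steinerDist a b c
  have hE : ∀ e, e ∈ H.edgeSet → e ∈ H.edgeSet.toFinset := fun e he => Set.mem_toFinset.2 he
  have hcard' : H.edgeSet.toFinset.card = G.steinerDist {a, b, c} := by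
    rw [Set.encard_eq_coe_toFinset_card] at hcard
    exact_mod_cast hcard
  calc ∑ B ∈ G.blocks, G.sepWeight B a b c
      ≤ ∑ B ∈ G.blocks, 2 * (H.edgeSet.toFinset.filter
          fun e => e ∈ ((⊤ : G.Subgraph).induce B).edgeSet).card :=
        Finset.sum_le_sum fun B _ => hH.sepWeight_le ha hb hc _ hE
    _ = 2 * ∑ B ∈ G.blocks, (H.edgeSet.toFinset.filter
          fun e => e ∈ ((⊤ : G.Subgraph).induce B).edgeSet).card := by rw [Finset.mul_sum]
    _ ≤ 2 * H.edgeSet.toFinset.card := by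
        rw [← Finset.card_biUnion]
        · exact Nat.mul_le_mul_left _ (Finset.card_le_card
            (Finset.biUnion_subset.2 fun B _ => Finset.filter_subset _ _))
        · intro B hB C hC hBC
          rw [Finset.mem_coe, mem_blocks] at hB hC
          refine Finset.disjoint_filter.2 fun e _ h1 h2 => hBC ?_
          induction e with
          | h x y =>
          rw [mem_edgeSet_induce_top] at h1 h2
          exact hG.block_eq hB hC h1.1.ne h1.2.1 h1.2.2 h2.2.1 h2.2.2
    _ = 2 * G.steinerDist {a, b, c} := by rw [hcard']

/-! ### Exact Steiner distance of a triple -/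

open scoped Classical in
/-- The number of blocks separating `a`, `b`, `c` into three components. -/
noncomputable def tripleCount [Fintype V] (G : SimpleGraph V) (a b c : V) : ℕ :=
  ∑ B ∈ G.blocks, if G.Separates B a b c then 1 else 0

theorem IsBlockGraph.le_two_mul_steinerDist [Fintype V] [DecidableEq V] (hG : G.IsBlockGraph)
    (hconn : G.Connected) (a b c : V) :
    G.dist a b + G.dist a c + G.dist b c + G.tripleCount a b c ≤ 2 * G.steinerDist {a, b, c} := by
  refine le_trans (le_of_eq ?_) (hG.sum_sepWeight_le hconn a b c)
  simp only [hG.dist_eq_sepCount hconn, sepCount, tripleCount, sepWeight, Finset.sum_add_distrib]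
  congr!

/-- The three gates form a triangle. If α, β, γ are the distances to them, the distances sum to
2(α+β+γ)+3, while the star centred at the gate of a has length α+β+γ+2. -/
theorem IsBlockGraph.two_mul_steinerDist_le_of_separates [Finite V] [DecidableEq V]
    (hG : G.IsBlockGraph) (hconn : G.Connected) (hB : G.IsBlock B) {a b c : V}
    (h : G.Separates B a b c) :
    2 * G.steinerDist {a, b, c} ≤ G.dist a b + G.dist a c + G.dist b c + 1 := by
  obtain ⟨hab, hac, hbc⟩ := h
  obtain ⟨x, hx, hax⟩ := exists_gate hconn hB a
  obtain ⟨y, hy, hby⟩ := exists_gate hconn hB b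
  obtain ⟨z, hz, hcz⟩ := exists_gate hconn hB c
  have hyx : y ≠ x := by rintro rfl; exact hab (hax.trans hby.symm)
  have hxz : x ≠ z := by rintro rfl; exact hac (hax.trans hcz.symm)
  have hyz : y ≠ z := by rintro rfl; exact hbc (hby.trans hcz.symm)
  have d1 : G.dist y x = 1 := dist_eq_one_iff_adj.2 (hG B hB hy hx hyx)
  have d2 : G.dist x z = 1 := dist_eq_one_iff_adj.2 (hG B hB hx hz hxz)
  have d3 : G.dist y z = 1 := dist_eq_one_iff_adj.2 (hG B hB hy hz hyz)
  have e1 := hG.dist_gate hconn hB hx hax.symm (u := b) (fun h => hab h.symm)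
  have e2 := hG.dist_gate hconn hB hx hax.symm (u := c) (fun h => hac h.symm)
  have e3 := hG.dist_gate hconn hB hy hby.symm (u := c) (fun h => hbc h.symm)
  have e4 := hG.dist_gate hconn hB hz hcz.symm (u := y) (fun h => hbc (hby.trans h))
  have t1 := hconn.dist_triangle (u := b) (v := y) (w := x)
  have t2 := hconn.dist_triangle (u := c) (v := z) (w := x)
  have hle := hconn.steinerDist_le a b c x
  have c1 := G.dist_comm (u := a) (v := x)
  have c2 := G.dist_comm (u := b) (v := a)
  have c3 := G.dist_comm (u := c) (v := a)
  have c4 := G.dist_comm (u := c) (v := b)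
  have c5 := G.dist_comm (u := y) (v := b)
  have c6 := G.dist_comm (u := z) (v := c)
  have c7 := G.dist_comm (u := y) (v := c)
  have c8 := G.dist_comm (u := z) (v := x)
  lia

theorem tripleCount_pos [Fintype V] (hB : G.IsBlock B) {a b c : V} (h : G.Separates B a b c) :
    1 ≤ G.tripleCount a b c := by
  classical
  calc 1 = if G.Separates B a b c then 1 else 0 := by simp [h]
    _ ≤ _ := Finset.single_le_sum
      (f := fun B => if G.Separates B a b c then 1 else 0) (fun _ _ => Nat.zero_le _)
      (mem_blocks.2 hB)

theorem IsBlockGraph.two_mul_steinerDist [Fintype V] [DecidableEq V] (hG : G.IsBlockGraph)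
    (hconn : G.Connected) (a b c : V) : 2 * G.steinerDist {a, b, c} =
      G.dist a b + G.dist a c + G.dist b c + G.tripleCount a b c := by
  refine le_antisymm ?_ (hG.le_two_mul_steinerDist hconn a b c)
  by_cases h : ∃ B, G.IsBlock B ∧ G.Separates B a b c
  · obtain ⟨B, hB, hs⟩ := h
    have h1 := hG.two_mul_steinerDist_le_of_separates hconn hB hs
    have h2 := tripleCount_pos hB hs
    -- A positive `tripleCount` absorbs the extra 1; with the lower bound this forces it to equal 1.
    lia
  · push Not at h
    obtain ⟨m, ⟨h1, h2⟩, h3⟩ := hG.isModularTriple hconn h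
    rw [mem_geodesicInterval_iff hconn] at h1 h2 h3
    have hle := hconn.steinerDist_le a b c m
    have c1 := G.dist_comm (u := m) (v := b)
    have c2 := G.dist_comm (u := m) (v := c)
    lia

theorem IsBlockGraph.two_mul_steinerDist_of_not_isModularTriple [Fintype V] [DecidableEq V]
    (hG : G.IsBlockGraph) (hconn : G.Connected) {a b c : V} (h : ¬ G.IsModularTriple a b c) :
    2 * G.steinerDist {a, b, c} = G.dist a b + G.dist a c + G.dist b c + 1 := by
  obtain ⟨B, hB, hs⟩ : ∃ B, G.IsBlock B ∧ G.Separates B a b c := by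
    by_contra! hn
    exact h (hG.isModularTriple hconn hn)
  have h1 := hG.two_mul_steinerDist_le_of_separates hconn hB hs
  have h2 := tripleCount_pos hB hs
  have h3 := hG.le_two_mul_steinerDist hconn a b c
  lia

/-! ### Summation over all triples -/

/-- Summing a function of unordered pairs vanishing on the diagonal over all triples. -/
theorem sum_powersetCard_three_sum_sym2 [Fintype V] [DecidableEq V] (f : Sym2 V → ℕ)
    (hf : ∀ v, f s(v, v) = 0) :
    ∑ S ∈ (Finset.univ : Finset V).powersetCard 3, ∑ e ∈ S.sym2, f e =
      (Fintype.card V - 2) * ∑ e, f e := by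
  calc ∑ S ∈ (Finset.univ : Finset V).powersetCard 3, ∑ e ∈ S.sym2, f e
      = ∑ S ∈ (Finset.univ : Finset V).powersetCard 3, ∑ e, if e ∈ S.sym2 then f e else 0 := by
        refine Finset.sum_congr rfl fun S _ => ?_
        rw [← Finset.sum_filter]
        exact Finset.sum_congr (by ext; simp) fun _ _ => rfl
    _ = ∑ e, ∑ S ∈ (Finset.univ : Finset V).powersetCard 3, if e ∈ S.sym2 then f e else 0 :=
        Finset.sum_comm
    _ = ∑ e, (Fintype.card V - 2) * f e := by
        refine Finset.sum_congr rfl fun e _ => ?_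
        induction e with
        | h a b =>
        by_cases hab : a = b
        · subst hab; simp [hf]
        -- A pair of distinct vertices extends to a triple by any of the other n - 2 vertices.
        · rw [← Finset.sum_filter, Finset.sum_const, smul_eq_mul]
          congr 1
          have hfil : ((Finset.univ : Finset V).powersetCard 3).filter (s(a, b) ∈ ·.sym2) =
              ((Finset.univ : Finset V).powersetCard 3).filter ({a, b} ⊆ ·) := by
            refine Finset.filter_congr fun S _ => ?_
            rw [Finset.mk_mem_sym2_iff]
            simp [Finset.insert_subset_iff]
          have hcard : ({a, b} : Finset V).card = 2 := Finset.card_pair hab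
          rw [hfil, Finset.card_filter_powersetCard_subset _ _ _ (Finset.subset_univ _)
            (by lia), hcard, Finset.card_univ]
          simp
    _ = (Fintype.card V - 2) * ∑ e, f e := by rw [Finset.mul_sum]

theorem sum_sym2_triple [DecidableEq V] (f : Sym2 V → ℕ) (hf : ∀ v, f s(v, v) = 0) {a b c : V}
    (hab : a ≠ b) (hac : a ≠ c) (hbc : b ≠ c) :
    ∑ e ∈ ({a, b, c} : Finset V).sym2, f e = f s(a, b) + f s(a, c) + f s(b, c) := by
  have h : ({a, b, c} : Finset V).sym2 =
      {s(a, a), s(b, b), s(c, c), s(a, b), s(a, c), s(b, c)} := by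
    ext e
    induction e with
    | h x y =>
    simp only [Finset.mk_mem_sym2_iff, Finset.mem_insert, Finset.mem_singleton, Sym2.eq_iff]
    tauto
  rw [h]
  repeat rw [Finset.sum_insert (by simp [hab, hac, hbc, hab.symm, hac.symm, hbc.symm])]
  simp only [Finset.sum_singleton, hf]
  lia

-- A set S with image T picks one vertex from each component in T, and the components tell which is
-- which, so these sets biject with the product of the supports.
open scoped Classical in
theorem card_filter_image_connectedComponentMk [Fintype V] (H : SimpleGraph V)
    (T : Finset H.ConnectedComponent) (hT : T.card = 3) :
    (((Finset.univ : Finset V).powersetCard 3).filter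
      fun S => S.image H.connectedComponentMk = T).card = ∏ C ∈ T, C.supp.ncard := by
  obtain ⟨C, D, E, hCD, hCE, hDE, rfl⟩ := Finset.card_eq_three.1 hT
  rw [Finset.prod_insert (by simp [hCD, hCE]), Finset.prod_insert (by simp [hDE]),
    Finset.prod_singleton, Set.ncard_eq_toFinset_card', Set.ncard_eq_toFinset_card',
    Set.ncard_eq_toFinset_card', ← Finset.card_product, ← Finset.card_product]
  symm
  refine Finset.card_bij (fun x _ => {x.1, x.2.1, x.2.2}) ?_ ?_ ?_
  · rintro ⟨a, b, c⟩ h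
    simp only [Finset.mem_product, Set.mem_toFinset, ConnectedComponent.mem_supp_iff] at h
    obtain ⟨rfl, rfl, rfl⟩ := h
    simp only [Finset.mem_filter, Finset.mem_powersetCard, Finset.subset_univ, true_and,
      Finset.image_insert, Finset.image_singleton, and_true]
    exact Finset.card_eq_three.2 ⟨a, b, c, fun h => hCD (h ▸ rfl), fun h => hCE (h ▸ rfl),
      fun h => hDE (h ▸ rfl), rfl⟩
  · rintro ⟨a, b, c⟩ h ⟨a', b', c'⟩ h' heq
    simp only [Finset.mem_product, Set.mem_toFinset, ConnectedComponent.mem_supp_iff] at h h'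
    obtain ⟨rfl, rfl, rfl⟩ := h
    obtain ⟨ha, hb, hc⟩ := h'
    have h1 : a' ∈ ({a, b, c} : Finset V) := by rw [heq]; simp
    have h2 : b' ∈ ({a, b, c} : Finset V) := by rw [heq]; simp
    have h3 : c' ∈ ({a, b, c} : Finset V) := by rw [heq]; simp
    simp only [Finset.mem_insert, Finset.mem_singleton] at h1 h2 h3
    have e1 : a' = a := by
      rcases h1 with rfl | rfl | rfl
      · rfl
      · exact absurd ha.symm hCD
      · exact absurd ha.symm hCE
    have e2 : b' = b := by
      rcases h2 with rfl | rfl | rfl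
      · exact absurd hb hCD
      · rfl
      · exact absurd hb.symm hDE
    have e3 : c' = c := by
      rcases h3 with rfl | rfl | rfl
      · exact absurd hc hCE
      · exact absurd hc hDE
      · rfl
    rw [e1, e2, e3]
  · intro S hS
    rw [Finset.mem_filter, Finset.mem_powersetCard] at hS
    obtain ⟨⟨-, hS3⟩, hST⟩ := hS
    have hex : ∀ K ∈ ({C, D, E} : Finset H.ConnectedComponent),
        ∃ v ∈ S, H.connectedComponentMk v = K := fun K hK => by
      rw [← hST] at hK; simpa using hK
    obtain ⟨a, ha, rfl⟩ := hex C (by simp)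
    obtain ⟨b, hb, rfl⟩ := hex D (by simp)
    obtain ⟨c, hc, rfl⟩ := hex E (by simp)
    refine ⟨(a, b, c), by simp, Finset.eq_of_subset_of_card_le ?_ ?_⟩
    · simp [Finset.insert_subset_iff, ha, hb, hc]
    · rw [hS3]
      exact (Finset.card_eq_three.2 ⟨a, b, c, fun h => hCD (h ▸ rfl), fun h => hCE (h ▸ rfl),
        fun h => hDE (h ▸ rfl), rfl⟩).ge

open scoped Classical in
/-- `N₃` counts the triples of vertices lying in three distinct components. -/
theorem N₃_eq_card [Fintype V] (H : SimpleGraph V) :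
    H.N₃ = ∑ S ∈ (Finset.univ : Finset V).powersetCard 3,
      if (S.image H.connectedComponentMk).card = 3 then 1 else 0 := by
  rw [N₃, ← Finset.sum_filter, ← Finset.card_eq_sum_ones,
    Finset.card_eq_sum_card_fiberwise (f := fun S => S.image H.connectedComponentMk)
      (t := (Finset.univ : Finset H.ConnectedComponent).powersetCard 3)]
  · refine Finset.sum_congr (by congr!) fun T hT => ?_
    have hT3 := (Finset.mem_powersetCard.1 hT).2
    rw [← card_filter_image_connectedComponentMk H T hT3, Finset.filter_filter]
    congr 1
    refine Finset.filter_congr fun S _ => ⟨fun h => ⟨h ▸ hT3, h⟩, fun h => h.2⟩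
  · intro S hS
    exact Finset.mem_powersetCard.2 ⟨Finset.subset_univ _, (Finset.mem_filter.1 hS).2⟩

theorem separates_iff_card_image [DecidableEq V]
    [DecidableEq (G.deleteBlock B).ConnectedComponent] (a b c : V) :
    G.Separates B a b c ↔
      ((({a, b, c} : Finset V)).image (G.deleteBlock B).connectedComponentMk).card = 3 := by
  rw [Finset.image_insert, Finset.image_insert, Finset.image_singleton, Separates]
  simp only [← ConnectedComponent.eq]
  constructor
  · rintro ⟨h1, h2, h3⟩
    exact Finset.card_eq_three.2 ⟨_, _, _, h1, h2, h3, rfl⟩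
  · intro h
    have h4 := fun x y : (G.deleteBlock B).ConnectedComponent => Finset.card_le_two (a := x) (b := y)
    refine ⟨fun h' => ?_, fun h' => ?_, fun h' => ?_⟩
    · rw [h', Finset.insert_eq_of_mem (by simp)] at h
      have := h4 ((G.deleteBlock B).connectedComponentMk b) ((G.deleteBlock B).connectedComponentMk c)
      lia
    · rw [h', Finset.insert_eq_of_mem (by simp)] at h
      have := h4 ((G.deleteBlock B).connectedComponentMk b) ((G.deleteBlock B).connectedComponentMk c)
      lia
    · rw [h', Finset.insert_eq_of_mem (Finset.mem_singleton_self _)] at h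
      have := h4 ((G.deleteBlock B).connectedComponentMk a) ((G.deleteBlock B).connectedComponentMk c)
      lia

/-- Twice the Steiner `3`-Wiener index of a block graph. -/
theorem IsBlockGraph.two_mul_steinerWienerIndex [Fintype V] (hG : G.IsBlockGraph)
    (hconn : G.Connected) : 2 * G.steinerWienerIndex 3 =
      (Fintype.card V - 2) * G.wienerIndex + ∑ B ∈ G.blocks, (G.deleteBlock B).N₃ := by
  classical
  set f : Sym2 V → ℕ := Sym2.lift ⟨fun u v => G.dist u v, fun _ _ => G.dist_comm⟩ with hf
  have hf0 : ∀ v, f s(v, v) = 0 := fun v => by simp [hf]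
  have hW : G.wienerIndex = ∑ e, f e := by
    rw [wienerIndex]
  simp only [N₃_eq_card]
  rw [Finset.sum_comm, hW, ← sum_powersetCard_three_sum_sym2 f hf0, ← Finset.sum_add_distrib,
    steinerWienerIndex, Finset.mul_sum]
  refine Finset.sum_congr rfl fun S hS => ?_
  obtain ⟨a, b, c, hab, hac, hbc, rfl⟩ := Finset.card_eq_three.1 (Finset.mem_powersetCard.1 hS).2
  rw [hG.two_mul_steinerDist hconn, sum_sym2_triple f hf0 hab hac hbc, tripleCount]
  refine congrArg₂ _ rfl (Finset.sum_congr rfl fun B _ => ?_)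
  simp only [separates_iff_card_image]

end SimpleGraph

theorem mainTheorem5 {V : Type*} [Fintype V] [DecidableEq V] (G : SimpleGraph V)
    (hconn : G.Connected) (hblock : G.IsBlockGraph) :
    ((G.steinerWienerIndex 3 : ℕ) : ℚ)
        = ((Fintype.card V : ℚ) - 2) / 2 * (G.wienerIndex : ℚ)
          + 1 / 2 * ∑ B ∈ G.blocks, ((G.deleteBlock B).N₃ : ℚ) ∧
    ∀ a b c : V, ¬ G.IsModularTriple a b c →
      (G.steinerDist {a, b, c} : ℚ)
        = ((G.dist a b : ℚ) + (G.dist a c : ℚ) + (G.dist b c : ℚ)) / 2 + 1 / 2 := by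
  constructor
  · have h : (2 : ℚ) * G.steinerWienerIndex 3 = ((Fintype.card V - 2 : ℕ) : ℚ) * G.wienerIndex +
        ∑ B ∈ G.blocks, ((G.deleteBlock B).N₃ : ℚ) := by
      exact_mod_cast hblock.two_mul_steinerWienerIndex hconn
    have hn : ((Fintype.card V - 2 : ℕ) : ℚ) * G.wienerIndex =
        ((Fintype.card V : ℚ) - 2) * G.wienerIndex := by
      -- Truncated subtraction differs from n - 2 only for n < 2, where the Wiener index vanishes.
      rcases Nat.lt_or_ge (Fintype.card V) 2 with hlt | hge
      · have : Subsingleton V := Fintype.card_le_one_iff_subsingleton.1 (by lia)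
        have hW : G.wienerIndex = 0 := by
          refine Finset.sum_eq_zero fun e _ => ?_
          induction e with
          | h x y => simp [Subsingleton.elim x y]
        simp [hW]
      · rw [Nat.cast_sub hge, Nat.cast_ofNat]
    rw [hn] at h
    linarith
  · intro a b c habc
    have h : (2 : ℚ) * G.steinerDist {a, b, c} = G.dist a b + G.dist a c + G.dist b c + 1 := by
      exact_mod_cast hblock.two_mul_steinerDist_of_not_isModularTriple hconn habc
    linarith
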